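/- Let $X$ be a real normed space with dual $X^*$. An \emph{equivalent dual norm} on $X^*$ is a norm on $X^*$, equivalent to the canonical one, which is the dual norm of some equivalent norm on $X$. A norm $\|\cdot\|$ is \emph{rotund} if $\|x\|=\|y\|=\|\tfrac12(x+y)\|$ implies $x=y$. A \emph{symmetric} on a set $S$ is a function $\rho:S\times S\to[0,+\infty)$ such that, for all $x,y\in S$, $\rho(x,y)=\rho(y,x)$, and $\rho(x,y)=0$ if and only if $x=y$ (no triangle inequality is required). Then $X^*$ admits an equivalent dual rotund norm if and only if there exist a symmetric $\rho$ on $X^*$ and an equivalent dual norm $\|\cdot\|_\rho$ on $X^*$ such that, for every $x^*\in X^*$ with $\|x^*\|_\rho=1$ and every $\varepsilon>0$, there is a weak$^*$-neighbourhood $U$ of $x^*$ with \[\sup\{\rho(y^*,z^*) : y^*,z^*\in U\cap B_\rho\}<\varepsilon,\qquad B_\rho=\{y^*\in X^* : \|y^*\|_\rho\le 1\}.\] -/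

import Mathlib

open scoped Topology ENNReal

/-- A symmetric on a set `S`: a function `ρ : S × S → [0, ∞)` with `ρ x y = ρ y x`, vanishing
exactly on the diagonal. No triangle inequality is required. -/
structure IsSymmetricDist {S : Type*} (ρ : S → S → ℝ) : Prop where
  nonneg : ∀ x y, 0 ≤ ρ x y
  symm : ∀ x y, ρ x y = ρ y x
  eq_zero_iff : ∀ x y, ρ x y = 0 ↔ x = y

/-- The `ρ`-diameter `sup {ρ y z | y, z ∈ A}`, with values in `[0, ∞]`. -/
noncomputable def symmDiam {S : Type*} (ρ : S → S → ℝ) (A : Set S) : ℝ≥0∞ :=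
  ⨆ y ∈ A, ⨆ z ∈ A, ENNReal.ofReal (ρ y z)

/-- `p` is a norm on `E` equivalent to the given norm of `E`. (The lower bound makes the
seminorm `p` definite.) -/
def IsEquivalentNorm {E : Type*} [NormedAddCommGroup E] [NormedSpace ℝ E]
    (p : Seminorm ℝ E) : Prop :=
  ∃ c C : ℝ, 0 < c ∧ 0 < C ∧ ∀ x, c * ‖x‖ ≤ p x ∧ p x ≤ C * ‖x‖

/-- `p` is an equivalent dual norm on `X*`: it is equivalent to the canonical norm of `X*`, and it
is the dual norm of some equivalent norm `q` on `X`, i.e. `p f = sup {|f x| | q x ≤ 1}`. -/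
def IsEquivalentDualNorm {X : Type*} [NormedAddCommGroup X] [NormedSpace ℝ X]
    (p : Seminorm ℝ (StrongDual ℝ X)) : Prop :=
  IsEquivalentNorm p ∧
    ∃ q : Seminorm ℝ X, IsEquivalentNorm q ∧
      ∀ f : StrongDual ℝ X, IsLUB {r : ℝ | ∃ x : X, q x ≤ 1 ∧ r = |f x|} (p f)

/-- `p` is rotund (strictly convex): `p x = p y = p ((x + y) / 2)` implies `x = y`. -/
def IsRotund {E : Type*} [AddCommGroup E] [Module ℝ E] (p : Seminorm ℝ E) : Prop :=
  ∀ x y : E, p x = p y → p y = p ((1 / 2 : ℝ) • (x + y)) → x = y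

/-! ### Weak* slices and the slice derivation. -/

section WeakStar

variable {X : Type*} [NormedAddCommGroup X] [NormedSpace ℝ X]

/-! If `p` is a rotund dual norm, the midpoint defect (p(x)² + p(y)²)/2 - p((x+y)/2)² is a
symmetric, and it is small on slices of the ball near the sphere.

Conversely, let B be the ball of the given dual norm. For each n, repeatedly remove all slices on
which ρ, at pairs of points and at pairs of their negatives, stays below 1/(n+1). Every sphere point
disappears after finitely many steps (`exists_notMem_sliceDerivative_iterate`): otherwise some slice
of the intersection K of all stages consists of points with small neighbourhoods; Krein-Milman gives
an extreme point of K in it, Choquet's lemma a small slice of K there, and compactness passes this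
to a finite stage.

The stages are symmetric, convex and weak* compact, so countably many seminorms, built from
truncated polars, detect membership in them. Let N be a weighted ℓ²-sum of these and `p`. If N has a
midpoint equality at x, y on the sphere, with midpoint m, all three points lie in the last stage
containing m, and the small slice that removes m contains x or y. So ρ(x,m) or ρ(y,m) is below
1/(n+1), impossible for large n unless x = y. Only one value of ρ is used at a time, so no triangle
inequality is needed. -/

theorem WeakDual.exists_eval_lt_of_notMem {C : Set (WeakDual ℝ X)} (hC : Convex ℝ C)
    (hCc : IsClosed C) {x : WeakDual ℝ X} (hx : x ∉ C) :
    ∃ (f : X) (a : ℝ), (∀ y ∈ C, y f < a) ∧ a < x f := by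
  have : LocallyConvexSpace ℝ (WeakDual ℝ X) :=
    inferInstanceAs (LocallyConvexSpace ℝ (WeakBilin (topDualPairing ℝ X)))
  obtain ⟨φ, a, h1, h2⟩ := geometric_hahn_banach_closed_point hC hCc hx
  obtain ⟨f, hf⟩ := LinearMap.dualEmbedding_surjective (topDualPairing ℝ X) φ
  have key : ∀ y : WeakDual ℝ X, y f = φ y := fun y => by
    rw [← hf]; rfl
  exact ⟨f, a, fun y hy => by rw [key]; exact h1 y hy, by rw [key]; exact h2⟩

theorem WeakDual.convex_eval_le (f : X) (a : ℝ) : Convex ℝ {y : WeakDual ℝ X | y f ≤ a} := by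
  intro y hy z hz s t hs ht hst
  simp only [Set.mem_ofPred_eq] at *
  change s * y f + t * z f ≤ a
  calc s * y f + t * z f ≤ s * a + t * a := by gcongr
    _ = a := by rw [← add_mul, hst, one_mul]

theorem WeakDual.isClosed_eval_le (f : X) (a : ℝ) : IsClosed {y : WeakDual ℝ X | y f ≤ a} :=
  isClosed_le (WeakDual.eval_continuous f) continuous_const

theorem WeakDual.convex_le_eval (f : X) (a : ℝ) : Convex ℝ {y : WeakDual ℝ X | a ≤ y f} := by
  intro y hy z hz s t hs ht hst
  simp only [Set.mem_ofPred_eq] at *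
  change a ≤ s * y f + t * z f
  calc a = s * a + t * a := by rw [← add_mul, hst, one_mul]
    _ ≤ s * y f + t * z f := by gcongr

theorem WeakDual.isClosed_le_eval (f : X) (a : ℝ) : IsClosed {y : WeakDual ℝ X | a ≤ y f} :=
  isClosed_le continuous_const (WeakDual.eval_continuous f)

/-- Two compact convex sets missing an extreme point lie in a common compact convex set
missing it. -/
theorem exists_compact_convex_superset_union {E : Type*} [AddCommGroup E] [Module ℝ E]
    [TopologicalSpace E] [IsTopologicalAddGroup E] [ContinuousSMul ℝ E] {K C D : Set E} {e : E}
    (hK : Convex ℝ K) (he : e ∈ K.extremePoints ℝ)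
    (hC : IsCompact C) (hCc : Convex ℝ C) (hCK : C ⊆ K) (heC : e ∉ C)
    (hD : IsCompact D) (hDc : Convex ℝ D) (hDK : D ⊆ K) (heD : e ∉ D) :
    ∃ L, IsCompact L ∧ Convex ℝ L ∧ L ⊆ K ∧ e ∉ L ∧ C ∪ D ⊆ L := by
  rcases C.eq_empty_or_nonempty with rfl | hCn
  · exact ⟨D, hD, hDc, hDK, heD, by simp⟩
  rcases D.eq_empty_or_nonempty with rfl | hDn
  · exact ⟨C, hC, hCc, hCK, heC, by simp⟩
  refine ⟨convexJoin ℝ C D, ?_, hCc.convexJoin hDc, ?_, ?_,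
    Set.union_subset (subset_convexJoin_left hDn) (subset_convexJoin_right hCn)⟩
  · have himg : convexJoin ℝ C D =
        (fun q : ℝ × E × E => (1 - q.1) • q.2.1 + q.1 • q.2.2) ''
          (Set.Icc (0 : ℝ) 1 ×ˢ C ×ˢ D) := by
      ext z
      simp only [mem_convexJoin, segment_eq_image, Set.mem_image, Set.mem_prod, Prod.exists]
      constructor
      · rintro ⟨c, hc, d, hd, t, ht, rfl⟩
        exact ⟨t, c, d, ⟨ht, hc, hd⟩, rfl⟩
      · rintro ⟨t, c, d, ⟨ht, hc, hd⟩, rfl⟩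
        exact ⟨c, hc, d, hd, t, ht, rfl⟩
    rw [himg]
    exact (isCompact_Icc.prod (hC.prod hD)).image (by fun_prop)
  · exact convexJoin_subset hCK hDK hK
  -- An extreme point of K on a segment from C to D must be one of its endpoints.
  · intro h
    obtain ⟨c, hc, d, hd, hs⟩ := mem_convexJoin.1 h
    have := (mem_extremePoints_iff_forall_segment.1 he).2 c (hCK hc) d (hDK hd) hs
    rcases this with rfl | rfl
    · exact heC hc
    · exact heD hd

/-- **Choquet's lemma**: at an extreme point of a weak* compact convex set, the slices form a
neighbourhood basis. -/
theorem WeakDual.exists_slice_subset_of_mem_extremePoints {K U : Set (WeakDual ℝ X)}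
    (hK : IsCompact K) (hKc : Convex ℝ K) {e : WeakDual ℝ X} (he : e ∈ K.extremePoints ℝ)
    (hU : IsOpen U) (heU : e ∈ U) :
    ∃ (f : X) (a : ℝ), a < e f ∧ ∀ y ∈ K, a ≤ y f → y ∈ U := by
  have hA : IsCompact (K \ U) := hK.diff hU
  obtain ⟨L, hL, hLc, -, heL, hAL⟩ : ∃ L, IsCompact L ∧ Convex ℝ L ∧ L ⊆ K ∧ e ∉ L ∧
      K \ U ⊆ L := by
    -- Compact induction: half-spaces cover K \ U locally, and extremality of e lets finitely many
    -- pieces be merged without capturing e.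
    refine hA.induction_on (p := fun s => ∃ L, IsCompact L ∧ Convex ℝ L ∧ L ⊆ K ∧ e ∉ L ∧ s ⊆ L)
      ⟨∅, by simp [convex_empty]⟩ ?_ ?_ ?_
    · rintro s t hst ⟨L, h1, h2, h3, h4, h5⟩
      exact ⟨L, h1, h2, h3, h4, hst.trans h5⟩
    · rintro s t ⟨L, h1, h2, h3, h4, h5⟩ ⟨M, g1, g2, g3, g4, g5⟩
      obtain ⟨N, k1, k2, k3, k4, k5⟩ :=
        exists_compact_convex_superset_union hKc he h1 h2 h3 h4 g1 g2 g3 g4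
      exact ⟨N, k1, k2, k3, k4, (Set.union_subset_union h5 g5).trans k5⟩
    · rintro y ⟨hyK, hyU⟩
      have hye : y ≠ e := fun h => hyU (h ▸ heU)
      obtain ⟨f, hf⟩ : ∃ f : X, y f ≠ e f := by
        by_contra! h
        exact hye (DFunLike.ext _ _ h)
      have hev := WeakDual.eval_continuous (𝕜 := ℝ) f
      rcases lt_or_gt_of_ne hf with h | h
      · obtain ⟨a, ha, ha'⟩ := exists_between h
        refine ⟨K ∩ {z : WeakDual ℝ X | z f ≤ a}, ?_, K ∩ {z : WeakDual ℝ X | z f ≤ a},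
          hK.inter_right (isClosed_eval_le f a), hKc.inter (convex_eval_le f a),
          Set.inter_subset_left, fun h' => not_le.2 ha' h'.2, le_rfl⟩
        refine mem_nhdsWithin.2 ⟨{z | z f < a}, isOpen_lt hev continuous_const, ha, ?_⟩
        exact fun z hz => ⟨hz.2.1, (show z f < a from hz.1).le⟩
      · obtain ⟨a, ha, ha'⟩ := exists_between h
        refine ⟨K ∩ {z : WeakDual ℝ X | a ≤ z f}, ?_, K ∩ {z : WeakDual ℝ X | a ≤ z f},
          hK.inter_right (isClosed_le_eval f a), hKc.inter (convex_le_eval f a),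
          Set.inter_subset_left, fun h' => not_le.2 ha h'.2, le_rfl⟩
        refine mem_nhdsWithin.2 ⟨{z | a < z f}, isOpen_lt continuous_const hev, ha', ?_⟩
        exact fun z hz => ⟨hz.2.1, (show a < z f from hz.1).le⟩
  obtain ⟨f, a, h1, h2⟩ := exists_eval_lt_of_notMem hLc hL.isClosed heL
  exact ⟨f, a, h2, fun y hy hya => by_contra fun hyU => not_lt.2 hya (h1 y (hAL ⟨hy, hyU⟩))⟩

/-- A point at which the supremum over `T` equals `1` is separated by a slice from every compact
set on which the supremum over `T` is pointwise less than `1`. -/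
theorem WeakDual.exists_slice_disjoint_of_isCompact {T : Set X} {A : Set (WeakDual ℝ X)}
    (hA : IsCompact A) (hAT : ∀ y ∈ A, ∃ r < 1, ∀ f ∈ T, y f ≤ r)
    {x : WeakDual ℝ X} (hx : ∀ r < 1, ∃ f ∈ T, r < x f) :
    ∃ (f : X) (a : ℝ), (∀ y ∈ A, y f ≤ a) ∧ a < x f := by
  by_contra hcon
  have hmem : x ∈ closure (convexHull ℝ A) := by
    by_contra h
    obtain ⟨f, a, h1, h2⟩ :=
      exists_eval_lt_of_notMem (convex_convexHull ℝ A).closure isClosed_closure h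
    exact hcon ⟨f, a, fun y hy => (h1 y (subset_closure (subset_convexHull ℝ A hy))).le, h2⟩
  -- The values 1/4 beat the weights 2^(i+1) below, so that Φ n x < 1, while on A the weights force
  -- Φ n y to infinity. The bound r depends on y, so no uniform gap is available.
  have hx' : ∀ n : ℕ, ∃ f ∈ T, 1 - (1 / 4 : ℝ) ^ (n + 1) < x f := fun n => hx _ (by
    have : (0 : ℝ) < (1 / 4 : ℝ) ^ (n + 1) := by positivity
    linarith)
  choose f hfT hf using hx'
  let Φ : ℕ → WeakDual ℝ X → ℝ := fun n y => ∑ i ∈ Finset.range n, 2 ^ (i + 1) * (1 - y (f i))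
  have hΦc : ∀ n, Continuous (Φ n) := fun n =>
    continuous_finsetSum _ fun i _ => continuous_const.mul
      (continuous_const.sub (WeakDual.eval_continuous (f i)))
  have hterm : ∀ y ∈ A, ∀ i, 0 ≤ (2 : ℝ) ^ (i + 1) * (1 - y (f i)) := fun y hy i => by
    obtain ⟨r, hr, h⟩ := hAT y hy
    have := h (f i) (hfT i)
    exact mul_nonneg (by positivity) (by linarith)
  have hΦx : ∀ n, Φ n x < 1 := fun n => by
    have h1 : Φ n x ≤ ∑ i ∈ Finset.range n, (1 / 2 : ℝ) ^ (i + 1) := by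
      refine Finset.sum_le_sum fun i _ => ?_
      have h4 : (1 / 4 : ℝ) ^ (i + 1) = (1 / 2) ^ (i + 1) * (1 / 2) ^ (i + 1) := by
        rw [← mul_pow]; norm_num
      have h2 : (2 : ℝ) ^ (i + 1) * (1 / 2) ^ (i + 1) = 1 := by rw [← mul_pow]; norm_num
      calc (2 : ℝ) ^ (i + 1) * (1 - x (f i)) ≤ 2 ^ (i + 1) * (1 / 4) ^ (i + 1) := by
            gcongr; linarith [hf i]
        _ = (1 / 2) ^ (i + 1) := by rw [h4, ← mul_assoc, h2, one_mul]
    have h2 : ∀ m : ℕ, ∑ i ∈ Finset.range m, (1 / 2 : ℝ) ^ (i + 1) = 1 - (1 / 2) ^ m := by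
      intro m
      induction m with
      | zero => simp
      | succ m ih => rw [Finset.sum_range_succ, ih]; ring
    rw [h2] at h1
    have : (0 : ℝ) < (1 / 2) ^ n := by positivity
    linarith
  -- If Φ n, which is affine, were at least 1 on A, it would be so on the convex hull, which has
  -- points near x with Φ n < 1.
  have hne : ∀ n, (A ∩ {y | Φ n y ≤ 1}).Nonempty := fun n => by
    obtain ⟨z, hz1, hz2⟩ := mem_closure_iff.1 hmem {y | Φ n y < 1}
      (isOpen_lt (hΦc n) continuous_const) (hΦx n)
    by_contra hemp
    have hsub : A ⊆ {y | 1 ≤ Φ n y} := fun y hy => by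
      by_contra h
      exact hemp ⟨y, hy, show Φ n y ≤ 1 from (lt_of_not_ge h).le⟩
    have hconv : Convex ℝ {y | 1 ≤ Φ n y} := by
      intro y hy z hz s t hs ht hst
      have hcomb : Φ n (s • y + t • z) = s * Φ n y + t * Φ n z := by
        simp only [Φ, Finset.mul_sum, ← Finset.sum_add_distrib]
        refine Finset.sum_congr rfl fun i _ => ?_
        change (2 : ℝ) ^ (i + 1) * (1 - (s * y (f i) + t * z (f i))) = _
        linear_combination (-(2 : ℝ) ^ (i + 1)) * hst
      change 1 ≤ Φ n (s • y + t • z)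
      rw [hcomb]
      have hy' : 1 ≤ Φ n y := hy
      have hz' : 1 ≤ Φ n z := hz
      nlinarith
    exact absurd (show Φ n z < 1 from hz1) (not_lt.2 (convexHull_min hsub hconv hz2))
  obtain ⟨y, hy⟩ := IsCompact.nonempty_iInter_of_sequence_nonempty_isCompact_isClosed
    (fun n => A ∩ {y | Φ n y ≤ 1})
    (fun n y hy => ⟨hy.1, by
      have h := hterm y hy.1 n
      have h' : Φ (n + 1) y ≤ 1 := hy.2
      simp only [Φ, Finset.sum_range_succ] at h'
      change Φ n y ≤ 1
      simp only [Φ]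
      linarith⟩)
    hne (hA.inter_right (isClosed_le (hΦc 0) continuous_const))
    (fun n => hA.isClosed.inter (isClosed_le (hΦc n) continuous_const))
  rw [Set.mem_iInter] at hy
  obtain ⟨r, hr, hrT⟩ := hAT y (hy 0).1
  -- For this n the last term of Φ (n + 1) y is already at least 2.
  obtain ⟨n, hn⟩ := exists_pow_lt_of_lt_one (sub_pos.2 hr) (by norm_num : (1 / 2 : ℝ) < 1)
  have h1 : Φ (n + 1) y ≤ 1 := (hy (n + 1)).2
  have h2 : (2 : ℝ) ^ (n + 1) * (1 - y (f n)) ≤ Φ (n + 1) y :=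
    Finset.single_le_sum (f := fun i => (2 : ℝ) ^ (i + 1) * (1 - y (f i)))
      (fun i _ => hterm y (hy 0).1 i) (Finset.self_mem_range_succ n)
  have h3 := hrT (f n) (hfT n)
  have h4 : (2 : ℝ) ^ (n + 1) * (1 / 2) ^ n = 2 := by
    rw [pow_succ, mul_right_comm, ← mul_pow]; norm_num
  have h5 : (2 : ℝ) ^ (n + 1) * (1 / 2) ^ n ≤ 2 ^ (n + 1) * (1 - y (f n)) := by
    gcongr; linarith
  linarith

/-- Remove from `B` all slices `{y ∈ B | a < y f}`, `0 ≤ a`, which are small. -/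
def sliceDerivative (small : Set (WeakDual ℝ X) → Prop) (B : Set (WeakDual ℝ X)) :
    Set (WeakDual ℝ X) :=
  {x ∈ B | ∀ (f : X) (a : ℝ), 0 ≤ a → small {y ∈ B | a < y f} → x f ≤ a}

variable {small : Set (WeakDual ℝ X) → Prop} {B : Set (WeakDual ℝ X)}

theorem sliceDerivative_subset : sliceDerivative small B ⊆ B := fun _ h => h.1

theorem sliceDerivative_eq : sliceDerivative small B =
    B ∩ ⋂ (f : X) (a : ℝ) (_ : 0 ≤ a) (_ : small {y ∈ B | a < y f}), {x | x f ≤ a} := by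
  ext x
  simp [sliceDerivative]

theorem IsCompact.sliceDerivative (hB : IsCompact B) : IsCompact (sliceDerivative small B) := by
  rw [sliceDerivative_eq]
  exact hB.inter_right (isClosed_iInter fun f => isClosed_iInter fun a =>
    isClosed_iInter fun _ => isClosed_iInter fun _ => WeakDual.isClosed_eval_le f a)

theorem Convex.sliceDerivative (hB : Convex ℝ B) : Convex ℝ (sliceDerivative small B) := by
  rw [sliceDerivative_eq]
  exact hB.inter (convex_iInter fun f => convex_iInter fun a =>
    convex_iInter fun _ => convex_iInter fun _ => WeakDual.convex_eval_le f a)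

theorem zero_mem_sliceDerivative (hB : 0 ∈ B) : 0 ∈ sliceDerivative small B :=
  ⟨hB, fun _ _ ha _ => ha⟩

/-- Negation exchanges the slices by f and by -f at the same height, so symmetry survives when
smallness is itself symmetric. -/
theorem neg_mem_sliceDerivative (hsmall : ∀ D, small D → small {y | -y ∈ D})
    (hB : ∀ x ∈ B, -x ∈ B) {x : WeakDual ℝ X} (hx : x ∈ sliceDerivative small B) :
    -x ∈ sliceDerivative small B := by
  refine ⟨hB x hx.1, fun f a ha hs => ?_⟩
  have heq : {y | -y ∈ {y ∈ B | a < y f}} = {y ∈ B | a < y (-f)} := by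
    ext y
    have hneg : (-y) f = y (-f) := by rw [map_neg]; rfl
    simp only [Set.mem_ofPred_eq, hneg]
    exact and_congr_left' ⟨fun h => by simpa using hB _ h, fun h => hB _ h⟩
  have h := hx.2 (-f) a ha (heq ▸ hsmall _ hs)
  rw [map_neg] at h
  exact h

theorem sliceDerivative_iterate_anti {k l : ℕ} (h : k ≤ l) :
    (sliceDerivative small)^[l] B ⊆ (sliceDerivative small)^[k] B := by
  induction l, h using Nat.le_induction with
  | base => exact le_rfl
  | succ l _ ih =>
    rw [Function.iterate_succ_apply']
    exact sliceDerivative_subset.trans ih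

theorem IsCompact.sliceDerivative_iterate (hB : IsCompact B) (k : ℕ) :
    IsCompact ((_root_.sliceDerivative small)^[k] B) := by
  induction k with
  | zero => exact hB
  | succ k ih => rw [Function.iterate_succ_apply']; exact ih.sliceDerivative

theorem Convex.sliceDerivative_iterate (hB : Convex ℝ B) (k : ℕ) :
    Convex ℝ ((_root_.sliceDerivative small)^[k] B) := by
  induction k with
  | zero => exact hB
  | succ k ih => rw [Function.iterate_succ_apply']; exact ih.sliceDerivative

theorem zero_mem_sliceDerivative_iterate (hB : 0 ∈ B) (k : ℕ) :
    0 ∈ (sliceDerivative small)^[k] B := by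
  induction k with
  | zero => exact hB
  | succ k ih => rw [Function.iterate_succ_apply']; exact zero_mem_sliceDerivative ih

theorem neg_mem_sliceDerivative_iterate (hsmall : ∀ D, small D → small {y | -y ∈ D})
    (hB : ∀ x ∈ B, -x ∈ B) (k : ℕ) :
    ∀ x ∈ (sliceDerivative small)^[k] B, -x ∈ (sliceDerivative small)^[k] B := by
  induction k with
  | zero => exact hB
  | succ k ih =>
    rw [Function.iterate_succ_apply']
    exact fun x hx => neg_mem_sliceDerivative hsmall ih hx

/-- If the points of `S` have small neighbourhoods in `B`, finitely many derivations remove each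
of them. -/
theorem exists_notMem_sliceDerivative_iterate {S : Set (WeakDual ℝ X)}
    (hB : IsCompact B) (hBc : Convex ℝ B) (hB0 : 0 ∈ B)
    (hmono : ∀ D D', D ⊆ D' → small D' → small D)
    (hS : ∀ x ∈ S, ∃ U, IsOpen U ∧ x ∈ U ∧ 0 ∉ U ∧ small (U ∩ B))
    (hsep : ∀ A ⊆ B, IsCompact A → Disjoint A S → ∀ x ∈ S,
      ∃ (f : X) (a : ℝ), (∀ y ∈ A, y f ≤ a) ∧ a < x f)
    {x : WeakDual ℝ X} (hx : x ∈ S) : ∃ k, x ∉ (sliceDerivative small)^[k] B := by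
  by_contra! hxk
  have : LocallyConvexSpace ℝ (WeakDual ℝ X) :=
    inferInstanceAs (LocallyConvexSpace ℝ (WeakBilin (topDualPairing ℝ X)))
  set D : ℕ → Set (WeakDual ℝ X) := fun k => (sliceDerivative small)^[k] B with hD
  have hDcomp : ∀ k, IsCompact (D k) := hB.sliceDerivative_iterate
  have hDB : ∀ k, D k ⊆ B := fun k => sliceDerivative_iterate_anti (Nat.zero_le k)
  set K : Set (WeakDual ℝ X) := ⋂ k, D k with hKdef
  have hKB : K ⊆ B := Set.iInter_subset D 0
  have hK : IsCompact K := hB.of_isClosed_subset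
    (isClosed_iInter fun k => (hDcomp k).isClosed) hKB
  have hKc : Convex ℝ K := convex_iInter fun k => hBc.sliceDerivative_iterate k
  have hK0 : (0 : WeakDual ℝ X) ∈ K :=
    Set.mem_iInter.2 fun k => zero_mem_sliceDerivative_iterate hB0 k
  set G : Set (WeakDual ℝ X) := ⋃₀ {U | IsOpen U ∧ 0 ∉ U ∧ small (U ∩ B)} with hG
  have hGo : IsOpen G := isOpen_sUnion fun U hU => hU.1
  have hSG : Disjoint (K \ G) S := by
    rw [Set.disjoint_left]
    rintro y hy hyS
    obtain ⟨U, h1, h2, h3, h4⟩ := hS y hyS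
    exact hy.2 ⟨U, ⟨h1, h3, h4⟩, h2⟩
  -- K \ G is compact and misses S, so a slice of K around x lies inside G.
  obtain ⟨f, a, hfa, hxa⟩ := hsep (K \ G) (Set.sdiff_subset.trans hKB) (hK.diff hGo) hSG x hx
  obtain ⟨e, he, hea⟩ : ∃ e ∈ K.extremePoints ℝ, a < e f := by
    by_contra! h
    have hsub : closure (convexHull ℝ (K.extremePoints ℝ)) ⊆ {y : WeakDual ℝ X | y f ≤ a} :=
      closure_minimal (convexHull_min h (WeakDual.convex_eval_le f a))
        (WeakDual.isClosed_eval_le f a)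
    rw [closure_convexHull_extremePoints hK hKc] at hsub
    exact not_lt.2 (hsub (Set.mem_iInter.2 hxk)) hxa
  have heG : e ∈ G := by
    by_contra h
    exact not_lt.2 (hfa e ⟨he.1, h⟩) hea
  obtain ⟨U, ⟨hUo, hU0, hUs⟩, heU⟩ := heG
  obtain ⟨g, b, hgb, hgU⟩ := WeakDual.exists_slice_subset_of_mem_extremePoints hK hKc he hUo heU
  -- Only slices at nonnegative height are ever removed; this is why U must avoid 0.
  have hb : 0 ≤ b := by
    by_contra h
    exact hU0 (hgU 0 hK0 (not_le.1 h).le)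
  -- The slice of K lies in U, so by compactness the slice of some finite stage D k does too.
  have hempty : (⋂ k, D k ∩ ({y : WeakDual ℝ X | b ≤ y g} \ U)) = ∅ := by
    rw [← Set.iInter_inter, Set.eq_empty_iff_forall_notMem]
    rintro y ⟨hyK, hyb, hyU⟩
    exact hyU (hgU y hyK hyb)
  obtain ⟨k, hk⟩ : ∃ k, D k ∩ ({y : WeakDual ℝ X | b ≤ y g} \ U) = ∅ := by
    by_contra! h
    have hcl : IsClosed ({y : WeakDual ℝ X | b ≤ y g} \ U) :=
      (WeakDual.isClosed_le_eval g b).sdiff hUo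
    have := IsCompact.nonempty_iInter_of_sequence_nonempty_isCompact_isClosed
      (fun k => D k ∩ ({y : WeakDual ℝ X | b ≤ y g} \ U))
      (fun k => Set.inter_subset_inter_left _ (sliceDerivative_iterate_anti k.le_succ))
      (fun k => h k) ((hDcomp 0).inter_right hcl)
      (fun k => (hDcomp k).isClosed.inter hcl)
    exact this.ne_empty hempty
  have heD : e ∈ sliceDerivative small (D k) := by
    have := Set.mem_iInter.1 he.1 (k + 1)
    simp only [hD, Function.iterate_succ_apply'] at this
    exact this
  refine not_lt.2 (heD.2 g b hb (hmono _ _ ?_ hUs)) hgb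
  rintro y ⟨hyD, hyb⟩
  refine ⟨?_, hDB k hyD⟩
  by_contra hyU
  exact (Set.eq_empty_iff_forall_notMem.1 hk) y ⟨hyD, le_of_lt hyb, hyU⟩

end WeakStar

/-! ### Suprema and ℓ²-sums of seminorms; midpoint equalities. -/

section Seminorms

variable {E : Type*} [AddCommGroup E] [Module ℝ E]

/-- The supremum of the absolute values of a pointwise bounded family of linear functionals. -/
noncomputable def supAbsSeminorm {ι : Type*} (l : ι → E →ₗ[ℝ] ℝ)
    (hb : ∀ x, BddAbove (Set.range fun i => |l i x|)) : Seminorm ℝ E :=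
  Seminorm.of (fun x => ⨆ i, |l i x|)
    (fun x y => by
      refine Real.iSup_le (fun i => ?_) (add_nonneg (Real.iSup_nonneg fun i => abs_nonneg _)
        (Real.iSup_nonneg fun i => abs_nonneg _))
      rw [map_add]
      exact (abs_add_le _ _).trans (add_le_add (le_ciSup (hb x) i) (le_ciSup (hb y) i)))
    (fun a x => by
      simp only [map_smul, smul_eq_mul, abs_mul, Real.norm_eq_abs]
      exact (Real.mul_iSup_of_nonneg (abs_nonneg a) _).symm)

theorem le_supAbsSeminorm {ι : Type*} {l : ι → E →ₗ[ℝ] ℝ}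
    (hb : ∀ x, BddAbove (Set.range fun i => |l i x|)) (i : ι) (x : E) :
    |l i x| ≤ supAbsSeminorm l hb x :=
  le_ciSup (hb x) i

theorem supAbsSeminorm_le_iff {ι : Type*} {l : ι → E →ₗ[ℝ] ℝ}
    (hb : ∀ x, BddAbove (Set.range fun i => |l i x|)) {x : E} {r : ℝ} (hr : 0 ≤ r) :
    supAbsSeminorm l hb x ≤ r ↔ ∀ i, |l i x| ≤ r :=
  ⟨fun h i => (le_supAbsSeminorm hb i x).trans h, fun h => Real.iSup_le h hr⟩

/-- The `ℓ²`-sum of a sequence of seminorms. -/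
noncomputable def l2Seminorm (ψ : ℕ → Seminorm ℝ E) (hs : ∀ x, Summable fun n => ψ n x ^ 2) :
    Seminorm ℝ E :=
  Seminorm.of (fun x => √(∑' n, ψ n x ^ 2))
    (fun x y => by
      have h := Real.Lp_add_le_tsum_of_nonneg' (p := 2) one_le_two
        (f := fun n => ψ n x) (g := fun n => ψ n y)
        (fun n => apply_nonneg _ _) (fun n => apply_nonneg _ _)
        (by simpa using hs x) (by simpa using hs y)
      have hsum := Real.summable_Lp_add_of_nonneg (p := 2) one_le_two
        (f := fun n => ψ n x) (g := fun n => ψ n y)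
        (fun n => apply_nonneg _ _) (fun n => apply_nonneg _ _)
        (by simpa using hs x) (by simpa using hs y)
      simp only [Real.rpow_ofNat, ← Real.sqrt_eq_rpow] at h hsum
      refine le_trans (Real.sqrt_le_sqrt ((hs (x + y)).tsum_le_tsum (fun n => ?_) hsum)) h
      exact pow_le_pow_left₀ (apply_nonneg _ _) (map_add_le_add (ψ n) x y) 2)
    (fun a x => by
      simp only [map_smul_eq_mul, mul_pow]
      rw [tsum_mul_left, Real.sqrt_mul (by positivity), Real.sqrt_sq (norm_nonneg a)])

theorem l2Seminorm_sq (ψ : ℕ → Seminorm ℝ E) (hs : ∀ x, Summable fun n => ψ n x ^ 2) (x : E) :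
    l2Seminorm ψ hs x ^ 2 = ∑' n, ψ n x ^ 2 :=
  Real.sq_sqrt (tsum_nonneg fun _ => sq_nonneg _)

theorem Seminorm.map_midpoint_le (p : Seminorm ℝ E) (x y : E) :
    p ((1 / 2 : ℝ) • (x + y)) ≤ (p x + p y) / 2 := by
  rw [map_smul_eq_mul, Real.norm_of_nonneg (by norm_num)]
  linarith [map_add_le_add p x y]

/-- Midpoint convexity combined with ((a+b)/2)² + ((a-b)/2)² = (a²+b²)/2. -/
theorem Seminorm.sq_map_midpoint_le (p : Seminorm ℝ E) (x y : E) :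
    p ((1 / 2 : ℝ) • (x + y)) ^ 2 + ((p x - p y) / 2) ^ 2 ≤ (p x ^ 2 + p y ^ 2) / 2 := by
  nlinarith [p.map_midpoint_le x y, apply_nonneg p ((1 / 2 : ℝ) • (x + y)), apply_nonneg p x,
    apply_nonneg p y]

theorem Seminorm.eq_of_sq_map_midpoint_eq (p : Seminorm ℝ E) {x y : E}
    (h : p ((1 / 2 : ℝ) • (x + y)) ^ 2 = (p x ^ 2 + p y ^ 2) / 2) :
    p x = p y ∧ p y = p ((1 / 2 : ℝ) • (x + y)) := by
  have h1 := p.sq_map_midpoint_le x y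
  have h2 : p x = p y := by nlinarith [sq_nonneg ((p x - p y) / 2)]
  refine ⟨h2, ?_⟩
  rw [h2] at h
  exact (sq_eq_sq₀ (apply_nonneg _ _) (apply_nonneg _ _)).1 (by linarith)

/-- Equality in the midpoint inequality of an `ℓ²`-sum forces it in every summand. -/
theorem eq_of_l2Seminorm_midpoint {ψ : ℕ → Seminorm ℝ E} {hs : ∀ x, Summable fun n => ψ n x ^ 2}
    {x y : E} (hxy : l2Seminorm ψ hs x = l2Seminorm ψ hs y)
    (hm : l2Seminorm ψ hs y = l2Seminorm ψ hs ((1 / 2 : ℝ) • (x + y))) (n : ℕ) :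
    ψ n x = ψ n y ∧ ψ n y = ψ n ((1 / 2 : ℝ) • (x + y)) := by
  set m := (1 / 2 : ℝ) • (x + y) with hmdef
  -- The midpoint defects of the summands are nonnegative and add up to the total defect, which is
  -- zero.
  have hnonneg : ∀ n, 0 ≤ (ψ n x ^ 2 + ψ n y ^ 2) / 2 - ψ n m ^ 2 := fun n => by
    nlinarith [(ψ n).sq_map_midpoint_le x y, sq_nonneg ((ψ n x - ψ n y) / 2)]
  have hsum : HasSum (fun n => (ψ n x ^ 2 + ψ n y ^ 2) / 2 - ψ n m ^ 2)
      ((l2Seminorm ψ hs x ^ 2 + l2Seminorm ψ hs y ^ 2) / 2 - l2Seminorm ψ hs m ^ 2) := by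
    simp only [l2Seminorm_sq]
    exact (((hs x).hasSum.add (hs y).hasSum).div_const 2).sub (hs m).hasSum
  rw [hxy, hm, show ∀ a : ℝ, (a + a) / 2 - a = 0 from fun a => by ring] at hsum
  have h0 := congrFun ((hasSum_zero_iff_of_nonneg hnonneg).1 hsum) n
  refine (ψ n).eq_of_sq_map_midpoint_eq ?_
  simp only [Pi.zero_apply] at h0
  linarith

end Seminorms

/-! ### Dual norms and weak* closed balls. -/

section DualNorms

variable {X : Type*} [NormedAddCommGroup X] [NormedSpace ℝ X]

/-- The sublevel sets of `p` are weak* closed. -/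
def HasWeakStarClosedSublevels (p : Seminorm ℝ (StrongDual ℝ X)) : Prop :=
  ∀ r : ℝ, IsClosed {g : WeakDual ℝ X | p (WeakDual.toStrongDual g) ≤ r}

theorem IsEquivalentDualNorm.hasWeakStarClosedSublevels {p : Seminorm ℝ (StrongDual ℝ X)}
    (hp : IsEquivalentDualNorm p) : HasWeakStarClosedSublevels p := by
  intro r
  obtain ⟨-, q, -, hq⟩ := hp
  have : {g : WeakDual ℝ X | p (WeakDual.toStrongDual g) ≤ r} =
      ⋂ (x : X) (_ : q x ≤ 1), {g : WeakDual ℝ X | |g x| ≤ r} := by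
    ext g
    simp only [Set.mem_ofPred_eq, Set.mem_iInter]
    constructor
    · exact fun h x hx => ((hq _).1 ⟨x, hx, rfl⟩).trans h
    · intro h
      refine (hq _).2 ?_
      rintro _ ⟨x, hx, rfl⟩
      exact h x hx
  rw [this]
  exact isClosed_iInter fun x => isClosed_iInter fun _ =>
    isClosed_le (WeakDual.eval_continuous x).abs continuous_const

theorem Seminorm.convex_weakDual_le (p : Seminorm ℝ (StrongDual ℝ X)) (r : ℝ) :
    Convex ℝ {h : WeakDual ℝ X | p (WeakDual.toStrongDual h) ≤ r} := by
  intro h hh k hk s t hs ht hst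
  have hh' : p (WeakDual.toStrongDual h) ≤ r := hh
  have hk' : p (WeakDual.toStrongDual k) ≤ r := hk
  change p (s • WeakDual.toStrongDual h + t • WeakDual.toStrongDual k) ≤ r
  calc _ ≤ s * p (WeakDual.toStrongDual h) + t * p (WeakDual.toStrongDual k) := by
        refine (map_add_le_add p _ _).trans_eq ?_
        rw [map_smul_eq_mul, map_smul_eq_mul, Real.norm_of_nonneg hs, Real.norm_of_nonneg ht]
    _ ≤ s * r + t * r := by gcongr
    _ = r := by rw [← add_mul, hst, one_mul]

/-- An equivalent norm on the dual with weak* closed unit ball is a dual norm. -/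
theorem IsEquivalentNorm.isEquivalentDualNorm {p : Seminorm ℝ (StrongDual ℝ X)}
    (hp : IsEquivalentNorm p)
    (hcl : IsClosed {g : WeakDual ℝ X | p (WeakDual.toStrongDual g) ≤ 1}) :
    IsEquivalentDualNorm p := by
  refine ⟨hp, ?_⟩
  obtain ⟨c, C, hc, hC, hcC⟩ := hp
  -- The predual norm is the supremum over the `p`-ball; the bipolar argument below shows that its
  -- dual norm is `p`.
  let l : {g : StrongDual ℝ X // p g ≤ 1} → X →ₗ[ℝ] ℝ := fun g => g.1
  have hbd : ∀ x g, |l g x| ≤ c⁻¹ * ‖x‖ := fun x g => by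
    refine (g.1.le_opNorm x).trans ?_
    gcongr
    rw [← one_div, le_div_iff₀' hc]
    exact (hcC g.1).1.trans g.2
  have hb : ∀ x, BddAbove (Set.range fun g => |l g x|) := fun x =>
    ⟨c⁻¹ * ‖x‖, by rintro _ ⟨g, rfl⟩; exact hbd x g⟩
  have hscale : ∀ (g : StrongDual ℝ X) (r : ℝ), 0 < r → p g ≤ r → ∀ x,
      |g x| ≤ r * supAbsSeminorm l hb x := by
    intro g r hr hg x
    have hr' : p (r⁻¹ • g) ≤ 1 := by
      rw [map_smul_eq_mul, Real.norm_of_nonneg (by positivity), inv_mul_le_iff₀ hr, mul_one]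
      exact hg
    have h := le_supAbsSeminorm hb ⟨r⁻¹ • g, hr'⟩ x
    change |r⁻¹ * g x| ≤ _ at h
    rwa [abs_mul, abs_of_pos (inv_pos.2 hr), inv_mul_le_iff₀ hr] at h
  refine ⟨supAbsSeminorm l hb, ⟨C⁻¹, c⁻¹, inv_pos.2 hC, inv_pos.2 hc, fun x => ⟨?_, ?_⟩⟩, ?_⟩
  · obtain ⟨g, hg, hgx⟩ := exists_dual_vector'' ℝ x
    have h := hscale g C hC ((hcC g).2.trans (by nlinarith)) x
    rw [hgx] at h
    rw [inv_mul_le_iff₀ hC]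
    simpa using h
  · exact (supAbsSeminorm_le_iff hb (by positivity)).2 (hbd x)
  · intro g
    constructor
    · rintro _ ⟨x, hx, rfl⟩
      -- The margin ε covers p g = 0, since `hscale` needs a positive radius.
      refine le_of_forall_pos_le_add fun ε hε => ?_
      have hpos : 0 < p g + ε := by linarith [apply_nonneg p g]
      have := hscale g (p g + ε) hpos (by linarith) x
      nlinarith
    · intro b hub
      by_contra hlt
      have hb0 : 0 ≤ b := (abs_nonneg _).trans (hub ⟨0, by simp, rfl⟩)
      obtain ⟨r, hbr, hrg⟩ := exists_between (not_le.1 hlt)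
      have hr : 0 < r := hb0.trans_lt hbr
      -- Separating r⁻¹ • g from the ball by x at height a yields a⁻¹ • x in the predual ball, where
      -- g exceeds r > b.
      have hnot : StrongDual.toWeakDual (r⁻¹ • g) ∉
          {h : WeakDual ℝ X | p (WeakDual.toStrongDual h) ≤ 1} := by
        change ¬ (p (r⁻¹ • g) ≤ 1)
        rw [map_smul_eq_mul, Real.norm_of_nonneg (by positivity), inv_mul_le_iff₀ hr, mul_one]
        exact not_le.2 hrg
      obtain ⟨x, a, h1, h2⟩ := WeakDual.exists_eval_lt_of_notMem (p.convex_weakDual_le 1) hcl hnot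
      have ha : 0 < a := h1 0 (show p 0 ≤ 1 by simp)
      change a < r⁻¹ * g x at h2
      rw [lt_inv_mul_iff₀ hr] at h2
      have hqx : supAbsSeminorm l hb (a⁻¹ • x) ≤ 1 := by
        rw [map_smul_eq_mul, Real.norm_of_nonneg (by positivity), inv_mul_le_iff₀ ha, mul_one,
          supAbsSeminorm_le_iff hb ha.le]
        intro h
        refine abs_le'.2 ⟨(h1 (StrongDual.toWeakDual h.1) h.2).le, ?_⟩
        exact (h1 (StrongDual.toWeakDual (-h.1)) (show p (-h.1) ≤ 1 by
          rw [map_neg_eq_map]; exact h.2)).le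
      have h3 : |g (a⁻¹ • x)| ≤ b := hub ⟨_, hqx, rfl⟩
      rw [map_smul, smul_eq_mul] at h3
      have h4 : a⁻¹ * g x ≤ b := (le_abs_self _).trans h3
      rw [inv_mul_le_iff₀ ha] at h4
      nlinarith

/-- The ball is cut out by the finite partial sums, which are weak* lower semicontinuous. -/
theorem HasWeakStarClosedSublevels.l2Seminorm {ψ : ℕ → Seminorm ℝ (StrongDual ℝ X)}
    (hψ : ∀ n, HasWeakStarClosedSublevels (ψ n)) (hs : ∀ x, Summable fun n => ψ n x ^ 2) :
    IsClosed {g : WeakDual ℝ X | _root_.l2Seminorm ψ hs (WeakDual.toStrongDual g) ≤ 1} := by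
  have heq : {g : WeakDual ℝ X | _root_.l2Seminorm ψ hs (WeakDual.toStrongDual g) ≤ 1} =
      ⋂ s : Finset ℕ, (fun g : WeakDual ℝ X => ∑ n ∈ s, ψ n (WeakDual.toStrongDual g) ^ 2) ⁻¹'
        Set.Iic 1 := by
    ext g
    simp only [Set.mem_ofPred_eq, Set.mem_iInter, Set.mem_preimage, Set.mem_Iic]
    rw [← sq_le_one_iff₀ (apply_nonneg _ _), l2Seminorm_sq]
    exact ⟨fun h s => ((hs _).sum_le_tsum s fun n _ => sq_nonneg _).trans h,
      fun h => (hs _).tsum_le_of_sum_le h⟩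
  rw [heq]
  refine isClosed_iInter fun s => LowerSemicontinuous.isClosed_preimage ?_ 1
  refine lowerSemicontinuous_sum fun n _ => lowerSemicontinuous_iff_isClosed_preimage.2 fun r => ?_
  rcases lt_or_ge r 0 with hr | hr
  · convert isClosed_empty
    ext g
    simp only [Set.mem_preimage, Set.mem_Iic, Set.mem_empty_iff_false, iff_false, not_le]
    exact hr.trans_le (sq_nonneg _)
  · convert hψ n √r using 1
    ext g
    simp only [Set.mem_preimage, Set.mem_Iic, Set.mem_ofPred_eq]
    exact (Real.le_sqrt (apply_nonneg _ _) hr).symm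

/-- Countably many weak* lower semicontinuous seminorms can be absorbed into one equivalent dual
norm, whose midpoint equalities pass to all of them. -/
theorem IsEquivalentDualNorm.exists_midpoint_eq {p : Seminorm ℝ (StrongDual ℝ X)}
    (hp : IsEquivalentDualNorm p) {ι : Type*} [Countable ι] [Nonempty ι]
    (φ : ι → Seminorm ℝ (StrongDual ℝ X)) (hφ : ∀ i, HasWeakStarClosedSublevels (φ i))
    (hbd : ∀ i, ∃ C : ℝ, 0 < C ∧ ∀ g, φ i g ≤ C * p g) :
    ∃ N : Seminorm ℝ (StrongDual ℝ X), IsEquivalentDualNorm N ∧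
      ∀ x y, N x = N y → N y = N ((1 / 2 : ℝ) • (x + y)) →
        (p x = p y ∧ p y = p ((1 / 2 : ℝ) • (x + y))) ∧
        ∀ i, φ i x = φ i y ∧ φ i y = φ i ((1 / 2 : ℝ) • (x + y)) := by
  obtain ⟨e, he⟩ := exists_surjective_nat ι
  choose C hC hφC using hbd
  -- These weights give ψ n ≤ 2⁻ⁿ p, so the ℓ²-sum lies between p and 2p; p itself is the term of
  -- index 0.
  let w : ℕ → NNReal := fun n =>
    ⟨(1 / 2) ^ (n + 1) / C (e n), by have := hC (e n); positivity⟩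
  have hw : ∀ n, 0 < (w n : ℝ) := fun n => by
    have := hC (e n)
    change 0 < (1 / 2 : ℝ) ^ (n + 1) / C (e n)
    positivity
  let ψ : ℕ → Seminorm ℝ (StrongDual ℝ X) := fun n => Nat.casesOn n p fun n => w n • φ (e n)
  have hψs : ∀ n g, ψ (n + 1) g = w n * φ (e n) g := fun n g => rfl
  have hψp : ∀ n g, ψ n g ≤ (1 / 2) ^ n * p g := by
    rintro (_ | n) g
    · simp [ψ]
    · rw [hψs]
      calc (w n : ℝ) * φ (e n) g ≤ w n * (C (e n) * p g) := by gcongr; exact hφC _ _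
        _ = (1 / 2) ^ (n + 1) * p g := by
          change (1 / 2 : ℝ) ^ (n + 1) / C (e n) * (C (e n) * p g) = _
          field_simp [(hC (e n)).ne']
  have hψsq : ∀ g n, ψ n g ^ 2 ≤ (1 / 4) ^ n * p g ^ 2 := fun g n => by
    calc ψ n g ^ 2 ≤ ((1 / 2) ^ n * p g) ^ 2 := pow_le_pow_left₀ (apply_nonneg _ _) (hψp n g) 2
      _ = (1 / 4) ^ n * p g ^ 2 := by rw [mul_pow, pow_right_comm]; norm_num
  have hgeo : ∀ g, HasSum (fun n : ℕ => (1 / 4 : ℝ) ^ n * p g ^ 2) (4 / 3 * p g ^ 2) := fun g => by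
    have := (hasSum_geometric_of_lt_one (r := (1 / 4 : ℝ)) (by norm_num) (by norm_num)).mul_right
      (p g ^ 2)
    norm_num at this ⊢
    exact this
  have hs : ∀ g, Summable fun n => ψ n g ^ 2 := fun g =>
    Summable.of_nonneg_of_le (fun n => sq_nonneg _) (hψsq g) (hgeo g).summable
  have hlow : ∀ g, p g ≤ l2Seminorm ψ hs g := fun g => by
    refine (sq_le_sq₀ (apply_nonneg _ _) (apply_nonneg _ _)).1 ?_
    rw [l2Seminorm_sq]
    exact (hs g).le_tsum 0 fun n _ => sq_nonneg _
  have hup : ∀ g, l2Seminorm ψ hs g ≤ 2 * p g := fun g => by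
    refine (sq_le_sq₀ (apply_nonneg _ _) (mul_nonneg zero_le_two (apply_nonneg _ _))).1 ?_
    rw [l2Seminorm_sq]
    refine ((hs g).tsum_le_tsum (hψsq g) (hgeo g).summable).trans ?_
    rw [(hgeo g).tsum_eq]
    nlinarith [sq_nonneg (p g)]
  have hψcl : ∀ n, HasWeakStarClosedSublevels (ψ n) := by
    rintro (_ | n) r
    · exact hp.hasWeakStarClosedSublevels r
    · convert hφ (e n) (r / w n) using 1
      ext g
      simp only [Set.mem_ofPred_eq]
      rw [hψs, le_div_iff₀' (hw n)]
  refine ⟨l2Seminorm ψ hs, IsEquivalentNorm.isEquivalentDualNorm ?_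
    (HasWeakStarClosedSublevels.l2Seminorm hψcl hs), fun x y hxy hm => ?_⟩
  · obtain ⟨⟨c, D, hc, hD, h⟩, -⟩ := hp
    exact ⟨c, 2 * D, hc, by positivity, fun g => ⟨(h g).1.trans (hlow g),
      (hup g).trans (by linarith [(h g).2])⟩⟩
  · have hall := eq_of_l2Seminorm_midpoint hxy hm
    refine ⟨hall 0, fun i => ?_⟩
    obtain ⟨n, rfl⟩ := he i
    have := hall (n + 1)
    simp only [hψs] at this
    exact ⟨mul_left_cancel₀ (hw n).ne' this.1, mul_left_cancel₀ (hw n).ne' this.2⟩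

end DualNorms

/-! ### Polar seminorms of the derivatives and the two renormings. -/

section Renorming

variable {X : Type*} [NormedAddCommGroup X] [NormedSpace ℝ X]

/-- The part of norm at most `d` of the absolute polar of `D`. -/
def truncatedPolar (D : Set (WeakDual ℝ X)) (d : ℕ) : Set X :=
  {f | ‖f‖ ≤ d ∧ ∀ h ∈ D, |h f| ≤ 1}

theorem abs_apply_le_of_mem_truncatedPolar {D : Set (WeakDual ℝ X)} {d : ℕ}
    (f : truncatedPolar D d) (g : StrongDual ℝ X) :
    |ContinuousLinearMap.apply ℝ ℝ f.1 g| ≤ d * ‖g‖ := by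
  refine (g.le_opNorm f.1).trans ?_
  rw [mul_comm]
  gcongr
  exact f.2.1

/-- The seminorm `g ↦ sup |g f|` over the truncated polar of `D`. -/
noncomputable def truncatedPolarSeminorm (D : Set (WeakDual ℝ X)) (d : ℕ) :
    Seminorm ℝ (StrongDual ℝ X) :=
  supAbsSeminorm (fun f : truncatedPolar D d => (ContinuousLinearMap.apply ℝ ℝ f.1).toLinearMap)
    fun g => ⟨d * ‖g‖, by
      rintro _ ⟨f, rfl⟩
      exact abs_apply_le_of_mem_truncatedPolar f g⟩

theorem truncatedPolarSeminorm_le_iff {D : Set (WeakDual ℝ X)} {d : ℕ} {g : StrongDual ℝ X}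
    {r : ℝ} (hr : 0 ≤ r) :
    truncatedPolarSeminorm D d g ≤ r ↔ ∀ f ∈ truncatedPolar D d, |g f| ≤ r :=
  (supAbsSeminorm_le_iff _ hr).trans ⟨fun h f hf => h ⟨f, hf⟩, fun h f => h f.1 f.2⟩

theorem truncatedPolarSeminorm_le (D : Set (WeakDual ℝ X)) (d : ℕ) (g : StrongDual ℝ X) :
    truncatedPolarSeminorm D d g ≤ d * ‖g‖ :=
  (truncatedPolarSeminorm_le_iff (by positivity)).2
    fun f hf => abs_apply_le_of_mem_truncatedPolar ⟨f, hf⟩ g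

theorem truncatedPolarSeminorm_le_one {D : Set (WeakDual ℝ X)} (d : ℕ) {g : WeakDual ℝ X}
    (hg : g ∈ D) : truncatedPolarSeminorm D d (WeakDual.toStrongDual g) ≤ 1 :=
  (truncatedPolarSeminorm_le_iff zero_le_one).2 fun _ hf => hf.2 g hg

theorem hasWeakStarClosedSublevels_truncatedPolarSeminorm (D : Set (WeakDual ℝ X)) (d : ℕ) :
    HasWeakStarClosedSublevels (truncatedPolarSeminorm D d) := by
  intro r
  rcases lt_or_ge r 0 with hr | hr
  · convert isClosed_empty
    ext g
    simp only [Set.mem_ofPred_eq, Set.mem_empty_iff_false, iff_false, not_le]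
    exact hr.trans_le (apply_nonneg _ _)
  · have : {g : WeakDual ℝ X | truncatedPolarSeminorm D d (WeakDual.toStrongDual g) ≤ r} =
        ⋂ f ∈ truncatedPolar D d, {g : WeakDual ℝ X | |g f| ≤ r} := by
      ext g
      simp only [Set.mem_ofPred_eq, Set.mem_iInter, truncatedPolarSeminorm_le_iff hr]
      rfl
    rw [this]
    exact isClosed_iInter fun f => isClosed_iInter fun _ =>
      isClosed_le (WeakDual.eval_continuous f).abs continuous_const

/-- Dividing f by a number strictly between a and g f puts it in the polar with value above 1 at g.
The truncation is harmless because d is free. -/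
theorem exists_one_lt_truncatedPolarSeminorm {D : Set (WeakDual ℝ X)} {f : X} {a : ℝ}
    (ha : 0 ≤ a) (hD : ∀ h ∈ D, |h f| ≤ a) {g : WeakDual ℝ X} (hg : a < g f) :
    ∃ d, 1 < truncatedPolarSeminorm D d (WeakDual.toStrongDual g) := by
  obtain ⟨b, hab, hbg⟩ := exists_between hg
  have hb : 0 < b := ha.trans_lt hab
  obtain ⟨d, hd⟩ := exists_nat_ge ‖b⁻¹ • f‖
  have hmem : b⁻¹ • f ∈ truncatedPolar D d := by
    refine ⟨hd, fun h hh => ?_⟩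
    rw [map_smul, smul_eq_mul, abs_mul, abs_of_pos (inv_pos.2 hb), inv_mul_le_iff₀ hb, mul_one]
    exact (hD h hh).trans hab.le
  refine ⟨d, lt_of_not_ge fun h => ?_⟩
  have h1 := (truncatedPolarSeminorm_le_iff zero_le_one).1 h _ hmem
  rw [map_smul, smul_eq_mul] at h1
  have h2 := (le_abs_self _).trans h1
  rw [inv_mul_le_iff₀ hb, mul_one] at h2
  exact not_le.2 hbg h2

/-- The slice that removed x at its own stage still bounds every later, smaller stage. -/
theorem exists_slice_of_notMem_sliceDerivative_iterate {small : Set (WeakDual ℝ X) → Prop}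
    {B : Set (WeakDual ℝ X)} {x : WeakDual ℝ X} (hx : x ∈ B) {k : ℕ}
    (hxk : x ∉ (sliceDerivative small)^[k] B) :
    ∃ (f : X) (a : ℝ), 0 ≤ a ∧ a < x f ∧ ∀ h ∈ (sliceDerivative small)^[k] B, h f ≤ a := by
  induction k with
  | zero => exact absurd hx hxk
  | succ k ih =>
    by_cases hk : x ∈ (sliceDerivative small)^[k] B
    · rw [Function.iterate_succ_apply'] at hxk ⊢
      have : ∃ (f : X) (a : ℝ), 0 ≤ a ∧
          small {y ∈ (sliceDerivative small)^[k] B | a < y f} ∧ a < x f := by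
        by_contra! h
        exact hxk ⟨hk, h⟩
      obtain ⟨f, a, ha, hs, hxa⟩ := this
      exact ⟨f, a, ha, hxa, fun h hh => hh.2 f a ha hs⟩
    · obtain ⟨f, a, ha, hxa, h⟩ := ih hk
      exact ⟨f, a, ha, hxa, fun y hy => h y (sliceDerivative_iterate_anti k.le_succ hy)⟩

/-- If `m ∈ B` is the midpoint of `x, y ∈ B`, the truncated polar seminorms of the derivatives of
`B` agree at `x`, `y`, `m`, and `m` is removed by the derivation, then `m` lies in a common small
set with `x` or with `y`. -/
theorem exists_small_of_truncatedPolarSeminorm_eq {small : Set (WeakDual ℝ X) → Prop}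
    {B : Set (WeakDual ℝ X)} (hneg : ∀ D, small D → small {y | -y ∈ D})
    (hBneg : ∀ x ∈ B, -x ∈ B) {x y m : WeakDual ℝ X} (hx : x ∈ B) (hy : y ∈ B) (hm : m ∈ B)
    (hmid : ∀ f, m f = (x f + y f) / 2)
    (hxm : ∀ k d, truncatedPolarSeminorm ((sliceDerivative small)^[k] B) d
      (WeakDual.toStrongDual x) = truncatedPolarSeminorm ((sliceDerivative small)^[k] B) d
      (WeakDual.toStrongDual m))
    (hym : ∀ k d, truncatedPolarSeminorm ((sliceDerivative small)^[k] B) d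
      (WeakDual.toStrongDual y) = truncatedPolarSeminorm ((sliceDerivative small)^[k] B) d
      (WeakDual.toStrongDual m))
    (hk : ∃ k, m ∉ (sliceDerivative small)^[k] B) :
    ∃ D, small D ∧ m ∈ D ∧ (x ∈ D ∨ y ∈ D) := by
  obtain ⟨k, hmk, hmk'⟩ : ∃ k, m ∈ (sliceDerivative small)^[k] B ∧
      m ∉ (sliceDerivative small)^[k + 1] B := by
    by_contra! h
    obtain ⟨k, hk⟩ := hk
    exact hk (Nat.rec hm (fun k ih => h k ih) k)
  -- A point outside stage k has some truncated polar seminorm above 1, whereas at m all of them are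
  -- at most 1.
  have hmem : ∀ z ∈ B, (∀ d, truncatedPolarSeminorm ((sliceDerivative small)^[k] B) d
      (WeakDual.toStrongDual z) = truncatedPolarSeminorm ((sliceDerivative small)^[k] B) d
      (WeakDual.toStrongDual m)) → z ∈ (sliceDerivative small)^[k] B := by
    intro z hz hzm
    by_contra hzk
    obtain ⟨f, a, ha, hza, hD⟩ := exists_slice_of_notMem_sliceDerivative_iterate hz hzk
    obtain ⟨d, hd⟩ := exists_one_lt_truncatedPolarSeminorm ha
      (fun h hh => abs_le'.2 ⟨hD h hh, hD (-h) (neg_mem_sliceDerivative_iterate hneg hBneg k h hh)⟩)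
      hza
    rw [hzm d] at hd
    exact not_le.2 hd (truncatedPolarSeminorm_le_one d hmk)
  rw [Function.iterate_succ_apply'] at hmk'
  have : ∃ (f : X) (a : ℝ), 0 ≤ a ∧
      small {y ∈ (sliceDerivative small)^[k] B | a < y f} ∧ a < m f := by
    by_contra! h
    exact hmk' ⟨hmk, h⟩
  obtain ⟨f, a, -, hs, hma⟩ := this
  refine ⟨_, hs, ⟨hmk, hma⟩, ?_⟩
  -- Since m f is the average of x f and y f, one of these exceeds a.
  rw [hmid] at hma
  rcases lt_or_ge a (x f) with h | h
  · exact Or.inl ⟨hmem x hx (hxm k), h⟩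
  · exact Or.inr ⟨hmem y hy (hym k), by linarith⟩

theorem IsEquivalentDualNorm.isCompact_weakDual_le {p : Seminorm ℝ (StrongDual ℝ X)}
    (hp : IsEquivalentDualNorm p) (r : ℝ) :
    IsCompact {g : WeakDual ℝ X | p (WeakDual.toStrongDual g) ≤ r} := by
  obtain ⟨c, C, hc, -, h⟩ := hp.1
  refine (WeakDual.isCompact_closedBall (𝕜 := ℝ) (E := X) 0 (r / c)).of_isClosed_subset
    (hp.hasWeakStarClosedSublevels r) fun g hg => ?_
  simp only [Set.mem_preimage, Metric.mem_closedBall, dist_zero_right]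
  rw [le_div_iff₀' hc]
  exact (h _).1.trans hg

theorem IsEquivalentDualNorm.exists_slice_disjoint {p : Seminorm ℝ (StrongDual ℝ X)}
    (hp : IsEquivalentDualNorm p) {A : Set (WeakDual ℝ X)} (hA : IsCompact A)
    (hAp : ∀ y ∈ A, p (WeakDual.toStrongDual y) < 1) {x : WeakDual ℝ X}
    (hx : p (WeakDual.toStrongDual x) = 1) :
    ∃ (f : X) (a : ℝ), (∀ y ∈ A, y f ≤ a) ∧ a < x f := by
  obtain ⟨-, q, -, hq⟩ := hp
  refine WeakDual.exists_slice_disjoint_of_isCompact (T := {f | q f ≤ 1}) hA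
    (fun y hy => ⟨_, hAp y hy, fun f hf => ?_⟩) fun r hr => ?_
  · exact (le_abs_self _).trans ((hq (WeakDual.toStrongDual y)).1 ⟨f, hf, rfl⟩)
  · rw [← hx] at hr
    obtain ⟨_, ⟨f, hf, rfl⟩, hrf, -⟩ := (hq (WeakDual.toStrongDual x)).exists_between hr
    rcases lt_abs.1 hrf with h | h
    · exact ⟨f, hf, h⟩
    · exact ⟨-f, by change q (-f) ≤ 1; rw [map_neg_eq_map]; exact hf, by rw [map_neg]; exact h⟩

/-- A dual norm with small weak* neighbourhoods on its sphere, measured by a symmetric, can be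
replaced by a rotund one. -/
theorem exists_isRotund_of_symmetric {ρ : StrongDual ℝ X → StrongDual ℝ X → ℝ}
    (hρ : IsSymmetricDist ρ) {p : Seminorm ℝ (StrongDual ℝ X)} (hp : IsEquivalentDualNorm p)
    (hloc : ∀ f : StrongDual ℝ X, p f = 1 → ∀ ε : ℝ, 0 < ε →
      ∃ U ∈ 𝓝 (StrongDual.toWeakDual f), ∀ y z : StrongDual ℝ X,
        StrongDual.toWeakDual y ∈ U → p y ≤ 1 → StrongDual.toWeakDual z ∈ U → p z ≤ 1 →
          ρ y z < ε) :
    ∃ N : Seminorm ℝ (StrongDual ℝ X), IsEquivalentDualNorm N ∧ IsRotund N := by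
  set B : Set (WeakDual ℝ X) := {g | p (WeakDual.toStrongDual g) ≤ 1} with hBdef
  set S : Set (WeakDual ℝ X) := {g | p (WeakDual.toStrongDual g) = 1} with hSdef
  -- Controlling negatives as well makes smallness symmetric, hence the derivatives symmetric; ρ
  -- itself need not be invariant under negation.
  let small : ℕ → Set (WeakDual ℝ X) → Prop := fun n D => ∀ y ∈ D, ∀ z ∈ D,
    ρ (WeakDual.toStrongDual y) (WeakDual.toStrongDual z) < 1 / (n + 1) ∧
    ρ (WeakDual.toStrongDual (-y)) (WeakDual.toStrongDual (-z)) < 1 / (n + 1)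
  have hmono : ∀ n D D', D ⊆ D' → small n D' → small n D := fun n D D' h hD' y hy z hz =>
    hD' y (h hy) z (h hz)
  have hneg : ∀ n D, small n D → small n {y | -y ∈ D} := fun n D hD y hy z hz => by
    have := hD (-y) hy (-z) hz
    rw [neg_neg, neg_neg] at this
    exact this.symm
  have hBc : Convex ℝ B := p.convex_weakDual_le 1
  have hBk : IsCompact B := hp.isCompact_weakDual_le 1
  have hB0 : (0 : WeakDual ℝ X) ∈ B := by
    change p 0 ≤ 1
    simp
  have hBneg : ∀ x ∈ B, -x ∈ B := fun x hx => by
    change p (-WeakDual.toStrongDual x) ≤ 1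
    rw [map_neg_eq_map]
    exact hx
  have hnhds : ∀ n : ℕ, ∀ x ∈ S, ∃ U, IsOpen U ∧ x ∈ U ∧ 0 ∉ U ∧ small n (U ∩ B) := by
    intro n x hx
    have hε : (0 : ℝ) < 1 / (n + 1) := by positivity
    obtain ⟨U, hU, hUρ⟩ := hloc (WeakDual.toStrongDual x) hx _ hε
    obtain ⟨V, hV, hVρ⟩ := hloc (-WeakDual.toStrongDual x) (by rw [map_neg_eq_map]; exact hx) _ hε
    refine ⟨interior U ∩ ((fun y => -y) ⁻¹' interior V ∩ {0}ᶜ),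
      isOpen_interior.inter ((isOpen_interior.preimage continuous_neg).inter isOpen_compl_singleton),
      ⟨mem_interior_iff_mem_nhds.2 hU, mem_interior_iff_mem_nhds.2 hV, ?_⟩, fun h => h.2.2 rfl, ?_⟩
    · rintro rfl
      have : p 0 = 1 := hx
      simp at this
    · rintro y ⟨⟨hyU, hyV, -⟩, hyB⟩ z ⟨⟨hzU, hzV, -⟩, hzB⟩
      exact ⟨hUρ _ _ (interior_subset hyU) hyB (interior_subset hzU) hzB,
        hVρ _ _ (interior_subset hyV) (hBneg y hyB) (interior_subset hzV) (hBneg z hzB)⟩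
  have hsep : ∀ A ⊆ B, IsCompact A → Disjoint A S → ∀ x ∈ S,
      ∃ (f : X) (a : ℝ), (∀ y ∈ A, y f ≤ a) ∧ a < x f := fun A hAB hA hAS x hx =>
    hp.exists_slice_disjoint hA (fun y hy => lt_of_le_of_ne (hAB hy)
      fun h => Set.disjoint_left.1 hAS hy h) hx
  let φ : ℕ × ℕ × ℕ → Seminorm ℝ (StrongDual ℝ X) := fun i =>
    truncatedPolarSeminorm ((sliceDerivative (small i.1))^[i.2.1] B) i.2.2
  obtain ⟨N, hN, hNeq⟩ := hp.exists_midpoint_eq φ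
    (fun i => hasWeakStarClosedSublevels_truncatedPolarSeminorm _ _) (fun i => by
      obtain ⟨c, C, hc, -, h⟩ := hp.1
      refine ⟨(i.2.2 + 1) / c, by positivity, fun g => (truncatedPolarSeminorm_le _ _ g).trans ?_⟩
      have h1 : ‖g‖ ≤ p g / c := (le_div_iff₀' hc).2 (h g).1
      have h2 : (0 : ℝ) ≤ p g / c := div_nonneg (apply_nonneg _ _) hc.le
      calc (i.2.2 : ℝ) * ‖g‖ ≤ (i.2.2 + 1) * (p g / c) := by gcongr; linarith
        _ = (i.2.2 + 1) / c * p g := by ring)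
  have hunit : ∀ x y : StrongDual ℝ X, p x = 1 → N x = N y →
      N y = N ((1 / 2 : ℝ) • (x + y)) → x = y := by
    intro x y hx hxy hym
    set m := (1 / 2 : ℝ) • (x + y) with hm
    obtain ⟨⟨hp1, hp2⟩, hφ⟩ := hNeq x y hxy hym
    have hpm : p m = 1 := by rw [← hm] at hp2; rw [← hp2, ← hp1, hx]
    have hy : p y = 1 := hp1 ▸ hx
    by_contra hne
    have hxm : x ≠ m := fun h => hne (by
      have h2 : (2 : ℝ) • x = x + y := by
        conv_lhs => rw [h, hm]
        rw [smul_smul]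
        norm_num
      rw [two_smul] at h2
      exact add_left_cancel h2)
    have hym' : y ≠ m := fun h => hne (by
      have h2 : (2 : ℝ) • y = x + y := by
        conv_lhs => rw [h, hm]
        rw [smul_smul]
        norm_num
      rw [two_smul] at h2
      exact (add_right_cancel h2).symm)
    have hpos : ∀ u v, u ≠ v → 0 < ρ u v := fun u v h =>
      lt_of_le_of_ne (hρ.nonneg u v) fun h' => h ((hρ.eq_zero_iff u v).1 h'.symm)
    -- The small slice will contain m and one unspecified endpoint, so 1/(n+1) must lie below both ρ
    -- x m and ρ y m.
    obtain ⟨n, hn⟩ := exists_nat_one_div_lt (lt_min (hpos x m hxm) (hpos y m hym'))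
    obtain ⟨D, hD, hmD, hxyD⟩ := exists_small_of_truncatedPolarSeminorm_eq
      (small := small n) (B := B) (hneg n) hBneg
      (x := StrongDual.toWeakDual x) (y := StrongDual.toWeakDual y) (m := StrongDual.toWeakDual m)
      hx.le hy.le hpm.le
      (fun f => by
        change (1 / 2 : ℝ) * (x f + y f) = (x f + y f) / 2
        ring)
      (fun k d => ((hφ (n, k, d)).1.trans (hφ (n, k, d)).2))
      (fun k d => (hφ (n, k, d)).2)
      (exists_notMem_sliceDerivative_iterate hBk hBc hB0 (hmono n) (hnhds n) hsep hpm)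
    rcases hxyD with h | h
    · exact lt_asymm (hD _ h _ hmD).1 (hn.trans_le (min_le_left _ _))
    · exact lt_asymm (hD _ h _ hmD).1 (hn.trans_le (min_le_right _ _))
  refine ⟨N, hN, fun x y hxy hym => ?_⟩
  -- N-equality forces p x = p y, so homogeneity reduces everything to the `p`-sphere, apart from
  -- the zero vector.
  obtain ⟨⟨hp1, -⟩, -⟩ := hNeq x y hxy hym
  obtain ⟨c, C, hc, -, h⟩ := hp.1
  rcases (apply_nonneg p x).eq_or_lt with h0 | h0
  · have hzero : ∀ g, p g = 0 → g = 0 := fun g hg => by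
      have := (h g).1
      rw [hg] at this
      exact norm_le_zero_iff.1 (by nlinarith [norm_nonneg g])
    rw [hzero x h0.symm, hzero y (hp1 ▸ h0.symm)]
  · have hinv : (p x)⁻¹ ≠ 0 := (inv_pos.2 h0).ne'
    refine smul_right_injective _ hinv (hunit _ _ ?_ ?_ ?_)
    · rw [map_smul_eq_mul, Real.norm_of_nonneg (inv_pos.2 h0).le, inv_mul_cancel₀ h0.ne']
    · rw [map_smul_eq_mul, map_smul_eq_mul, hxy]
    · rw [← smul_add, smul_comm, map_smul_eq_mul, map_smul_eq_mul, ← hym]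

/-- The defect of the parallelogram-type midpoint inequality of a rotund dual norm is a symmetric
whose diameters are small near the sphere. -/
theorem exists_symmetric_of_isRotund {p : Seminorm ℝ (StrongDual ℝ X)}
    (hp : IsEquivalentDualNorm p) (hrot : IsRotund p) :
    ∃ ρ : StrongDual ℝ X → StrongDual ℝ X → ℝ, IsSymmetricDist ρ ∧
      ∀ f : StrongDual ℝ X, p f = 1 → ∀ ε : ℝ, 0 < ε →
        ∃ U ∈ 𝓝 (StrongDual.toWeakDual f), ∀ y z : StrongDual ℝ X,
          StrongDual.toWeakDual y ∈ U → p y ≤ 1 → StrongDual.toWeakDual z ∈ U → p z ≤ 1 →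
            ρ y z ≤ ε := by
  refine ⟨fun x y => (p x ^ 2 + p y ^ 2) / 2 - p ((1 / 2 : ℝ) • (x + y)) ^ 2,
    ⟨fun x y => ?_, fun x y => ?_, fun x y => ⟨fun h => ?_, ?_⟩⟩, fun f hf ε hε => ?_⟩
  · nlinarith [p.sq_map_midpoint_le x y, sq_nonneg ((p x - p y) / 2)]
  · rw [add_comm x y]
    ring
  · obtain ⟨h1, h2⟩ := p.eq_of_sq_map_midpoint_eq (x := x) (y := y) (by linarith)
    exact hrot x y h1 h2
  · rintro rfl
    rw [← two_smul ℝ x, smul_smul]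
    norm_num
  · obtain ⟨-, q, -, hq⟩ := hp
    obtain ⟨_, ⟨x, hx, rfl⟩, hlt, -⟩ :=
      (hq f).exists_between (show 1 - ε / 2 < p f by rw [hf]; linarith)
    obtain ⟨x, hx, hlt⟩ : ∃ x, q x ≤ 1 ∧ 1 - ε / 2 < f x := by
      rcases lt_abs.1 hlt with h | h
      · exact ⟨x, hx, h⟩
      · exact ⟨-x, by rw [map_neg_eq_map]; exact hx, by rw [map_neg]; exact h⟩
    -- Midpoints of points in this slice have norm t > 1 - ε/2, and t² ≥ 2t - 1 > 1 - ε bounds the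
    -- defect by ε.
    refine ⟨{g | 1 - ε / 2 < g x},
      (isOpen_lt continuous_const (WeakDual.eval_continuous x)).mem_nhds hlt,
      fun y z hyU hy hzU hz => ?_⟩
    have hyx : 1 - ε / 2 < y x := hyU
    have hzx : 1 - ε / 2 < z x := hzU
    have hm : 1 - ε / 2 < p ((1 / 2 : ℝ) • (y + z)) := by
      have h1 : |((1 / 2 : ℝ) • (y + z)) x| ≤ p ((1 / 2 : ℝ) • (y + z)) := (hq _).1 ⟨x, hx, rfl⟩
      have h2 : ((1 / 2 : ℝ) • (y + z)) x = (1 / 2 : ℝ) * (y x + z x) := rfl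
      linarith [le_abs_self (((1 / 2 : ℝ) • (y + z)) x)]
    have hy2 : p y ^ 2 ≤ 1 := pow_le_one₀ (apply_nonneg _ _) hy
    have hz2 : p z ^ 2 ≤ 1 := pow_le_one₀ (apply_nonneg _ _) hz
    change (p y ^ 2 + p z ^ 2) / 2 - p ((1 / 2 : ℝ) • (y + z)) ^ 2 ≤ ε
    nlinarith [sq_nonneg (p ((1 / 2 : ℝ) • (y + z)) - 1)]

theorem symmDiam_le_iff {S : Type*} {ρ : S → S → ℝ} {A : Set S} {r : ℝ} (hr : 0 ≤ r) :
    symmDiam ρ A ≤ ENNReal.ofReal r ↔ ∀ y ∈ A, ∀ z ∈ A, ρ y z ≤ r := by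
  simp only [symmDiam, iSup_le_iff, ENNReal.ofReal_le_ofReal_iff hr]

end Renorming

theorem mainTheorem10 {X : Type*} [NormedAddCommGroup X] [NormedSpace ℝ X] :
    (∃ p : Seminorm ℝ (StrongDual ℝ X), IsEquivalentDualNorm p ∧ IsRotund p) ↔
    (∃ ρ : StrongDual ℝ X → StrongDual ℝ X → ℝ, IsSymmetricDist ρ ∧
      ∃ p : Seminorm ℝ (StrongDual ℝ X), IsEquivalentDualNorm p ∧
        ∀ f : StrongDual ℝ X, p f = 1 → ∀ ε : ℝ, 0 < ε →
          ∃ U ∈ 𝓝 (StrongDual.toWeakDual f),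
            symmDiam ρ {g : StrongDual ℝ X | StrongDual.toWeakDual g ∈ U ∧ p g ≤ 1} <
              ENNReal.ofReal ε) := by
  constructor
  · rintro ⟨p, hp, hrot⟩
    obtain ⟨ρ, hρ, h⟩ := exists_symmetric_of_isRotund hp hrot
    refine ⟨ρ, hρ, p, hp, fun f hf ε hε => ?_⟩
    -- Halving ε keeps the supremum strictly below ε.
    obtain ⟨U, hU, hUρ⟩ := h f hf (ε / 2) (half_pos hε)
    refine ⟨U, hU, lt_of_le_of_lt ((symmDiam_le_iff (half_pos hε).le).2 ?_)
      ((ENNReal.ofReal_lt_ofReal_iff hε).2 (half_lt_self hε))⟩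
    exact fun y hy z hz => hUρ y z hy.1 hy.2 hz.1 hz.2
  · rintro ⟨ρ, hρ, p, hp, h⟩
    refine exists_isRotund_of_symmetric hρ hp fun f hf ε hε => ?_
    obtain ⟨U, hU, hUρ⟩ := h f hf (ε / 2) (half_pos hε)
    refine ⟨U, hU, fun y z hyU hy hzU hz => ?_⟩
    have := (symmDiam_le_iff (half_pos hε).le).1 hUρ.le y ⟨hyU, hy⟩ z ⟨hzU, hz⟩
    linarith
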